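/- Let $\varepsilon>0$ and let $(\mathcal X,d)$ be a proper metric space (closed bounded sets are compact) with its Borel $\sigma$-algebra. Write $B_\varepsilon(x)$ and $\overline B_\varepsilon(x)$ for open and closed balls. Assume that for all $x\in\mathcal X$ and $0<r<\varepsilon$ there is a measurable map $T_{x,r}\colon\overline B_\varepsilon(x)\to\overline B_{\varepsilon-r}(x)$ with $d(T_{x,r}(y),y)\le r$ for all $y\in\overline B_\varepsilon(x)$. Let $\mu$ be a Borel probability measure on $\mathcal X\times\{0,1\}$, $\rho_i:=\mu(\,\cdot\times\{i\})$ for $i\in\{0,1\}$, and $\rho:=\rho_0+\rho_1$. A random walk $\mathbf m=(m_x)_{x\in\mathcal X}$ is a family of Borel probability measures on $\mathcal X$ such that $x\mapsto m_x(A)$ is Borel for every Borel set $A$ and, for some $x_0\in\mathcal X$, $\int d(x_0,y)\,dm_x(y)<\infty$ for all $x$. Let $\mathfrak M$ be the set of random walks with $\operatorname{supp} m_x\subset\overline B_\varepsilon(x)$ for $\rho$-a.e. $x$. For continuous $u\colon\mathcal X\to\mathbb R$ set $\nabla_\varepsilon[u](x,y):=\frac{u(y)-u(x)}{\varepsilon}$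 and $$\mathrm{TV}_\varepsilon(u):=\int_{\mathcal X}\frac{\max_{\overline B_\varepsilon(x)}u-u(x)}{\varepsilon}\,d\rho_0(x)+\int_{\mathcal X}\frac{u(x)-\min_{\overline B_\varepsilon(x)}u}{\varepsilon}\,d\rho_1(x)\in[0,\infty].$$ For $\underline{\mathbf m}=(\mathbf m^0,\mathbf m^1)$ let $n_x:=\frac12(m^0_x+m^1_x)$, $$[\underline{\mathbf m};\boldsymbol\rho](x,y):=\frac{d\rho_0}{d\rho}(x)\frac{dm^0_x}{dn_x}(y)-\frac{d\rho_1}{d\rho}(x)\frac{dm^1_x}{dn_x}(y)$$ (with jointly measurable versions of the densities $dm^i_x/dn_x$), and let $\operatorname{div}^{\boldsymbol\rho}_\varepsilon[\underline{\mathbf m}]:=\operatorname{div}^{\rho_0}_\varepsilon[\mathbf m^0]-\operatorname{div}^{\rho_1}_\varepsilon[\mathbf m^1]$, where $\operatorname{div}^{\rho_i}_\varepsilon[\mathbf m]$ is the finite signed measure $$\operatorname{div}^{\rho_i}_\varepsilon[\mathbf m](A):=\frac1\varepsilon\Big(\int_A m_x(\mathcal X)\,d\rho_i(x)-\int_{\mathcal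 X}m_x(A)\,d\rho_i(x)\Big).$$ Then for every $u\in C(\mathcal X)$ the following hold, where outer integrals take values in $[-\infty,\infty]$ and $\infty-\infty:=-\infty$ (this case can only occur if $\mathrm{TV}_\varepsilon(u)=\infty$). 1. If $\nu$ is a $\sigma$-finite Borel measure on $\mathcal X$ with $\rho_0,\rho_1\ll\nu$ and $\{x:\operatorname{dist}(x,\operatorname{supp}\rho_i)\le\varepsilon\}\subset\operatorname{supp}\nu$ for $i\in\{0,1\}$, then $$\int_{\mathcal X}\frac{\nu\text{-}\operatorname{ess\,sup}_{B_\varepsilon(x)}u-u(x)}{\varepsilon}\,d\rho_0(x)+\int_{\mathcal X}\frac{u(x)-\nu\text{-}\operatorname{ess\,inf}_{B_\varepsilon(x)}u}{\varepsilon}\,d\rho_1(x)=\mathrm{TV}_\varepsilon(u).$$ 2. $\displaystyle\mathrm{TV}_\varepsilon(u)=\max_{\underline{\mathbf m}\in\mathfrak M\times\mathfrak M}\ \int_{\mathcal X}\int_{\mathcal X}\nabla_\varepsilon[u](x,y)\,dm^0_x(y)\,d\rho_0(x)+\int_{\mathcal X}\int_{\mathcal X}-\nabla_\varepsilon[u](x,y)\,dm^1_x(y)\,d\rho_1(x).$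 3. $\displaystyle\mathrm{TV}_\varepsilon(u)=\max_{\underline{\mathbf m}\in\mathfrak M\times\mathfrak M}\ \int_{\mathcal X}\int_{\mathcal X}\nabla_\varepsilon[u](x,y)\,[\underline{\mathbf m};\boldsymbol\rho](x,y)\,dn_x(y)\,d\rho(x).$ For every bounded continuous $u\in C_b(\mathcal X)$, moreover, $$\mathrm{TV}_\varepsilon(u)=\max_{\underline{\mathbf m}\in\mathfrak M\times\mathfrak M}\ -\int_{\mathcal X}u\,d\operatorname{div}^{\boldsymbol\rho}_\varepsilon[\underline{\mathbf m}].$$ All maxima are attained. -/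

import Mathlib

open MeasureTheory ProbabilityTheory Set
open scoped ENNReal BoundedContinuousFunction

noncomputable section

namespace AdvTV

/-- The shrinking-map assumption at radius `ε`: every closed ball of radius `ε` is mapped
measurably into the concentric closed ball of radius `ε - r`, moving no point by more than `r`. -/
def ShrinkingMaps (X : Type*) [MetricSpace X] [MeasurableSpace X] (ε : ℝ) : Prop :=
  ∀ (x : X) (r : ℝ), 0 < r → r < ε →
    ∃ T : Metric.closedBall x ε → Metric.closedBall x (ε - r),
      Measurable T ∧ ∀ y, dist (T y : X) (y : X) ≤ r

/-- The (un-normalized) class-conditional distribution `μ(· × {i})`. -/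
def classCond {X : Type*} [MeasurableSpace X] (μ : Measure (X × Fin 2)) (i : Fin 2) : Measure X :=
  (μ.restrict (univ ×ˢ {i})).map Prod.fst

theorem classCond_apply {X : Type*} [MeasurableSpace X] (μ : Measure (X × Fin 2)) (i : Fin 2)
    {A : Set X} (hA : MeasurableSet A) : classCond μ i A = μ (A ×ˢ {i}) := by
  rw [classCond, Measure.map_apply measurable_fst hA,
    Measure.restrict_apply (measurable_fst hA)]
  congr 1
  ext p
  simp

instance {X : Type*} [MeasurableSpace X] (μ : Measure (X × Fin 2)) [IsFiniteMeasure μ]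
    (i : Fin 2) : IsFiniteMeasure (classCond μ i) := by
  unfold classCond
  infer_instance

/-- The dominating measure `ρ = ρ₀ + ρ₁`. -/
def total {X : Type*} [MeasurableSpace X] (μ : Measure (X × Fin 2)) : Measure X :=
  classCond μ 0 + classCond μ 1

/-- The Lebesgue integral with values in `[-∞, ∞]`: the integral of the positive part minus the
integral of the negative part, which is the usual one unless both are infinite. -/
def extIntegral {X : Type*} [MeasurableSpace X] (ρ : Measure X) (f : X → ℝ) : EReal :=
  ((∫⁻ x, ENNReal.ofReal (f x) ∂ρ : ℝ≥0∞) : EReal)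
    - ((∫⁻ x, ENNReal.ofReal (-f x) ∂ρ : ℝ≥0∞) : EReal)

/-- The adversarial total variation of a continuous function: maximum and minimum are taken
over closed balls, which are compact in a proper space. -/
def advTV {X : Type*} [MetricSpace X] [MeasurableSpace X] (ε : ℝ) (μ : Measure (X × Fin 2))
    (u : X → ℝ) : EReal :=
  extIntegral (classCond μ 0) (fun x => (sSup (u '' Metric.closedBall x ε) - u x) / ε)
    + extIntegral (classCond μ 1) (fun x => (u x - sInf (u '' Metric.closedBall x ε)) / ε)

/-- The adversarial total variation relative to a reference measure `ν`, with essential suprema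
and infima over open balls. -/
def refTV {X : Type*} [MetricSpace X] [MeasurableSpace X] (ε : ℝ) (μ : Measure (X × Fin 2))
    (ν : Measure X) (u : X → ℝ) : EReal :=
  extIntegral (classCond μ 0) (fun x => (essSup u (ν.restrict (Metric.ball x ε)) - u x) / ε)
    + extIntegral (classCond μ 1)
        (fun x => (u x - essInf u (ν.restrict (Metric.ball x ε))) / ε)

/-- Admissible reference measures: σ-finite, dominating both class-conditional distributions, and
with the closed `ε`-neighbourhoods of their supports contained in the support of `ν`. (Local
doubling of `ν` is not required.) -/
structure IsReferenceMeasure {X : Type*} [MetricSpace X] [MeasurableSpace X] (ε : ℝ)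
    (μ : Measure (X × Fin 2)) (ν : Measure X) : Prop where
  sigmaFinite : SigmaFinite ν
  absolutelyContinuous : ∀ i, classCond μ i ≪ ν
  support_subset : ∀ i, Metric.cthickening ε (classCond μ i).support ⊆ ν.support

/-- A random walk: a family of probability measures `m_x`, depending measurably on `x`, each
with finite first moment. -/
structure RandomWalk (X : Type*) [MetricSpace X] [MeasurableSpace X] where
  toKernel : Kernel X X
  isMarkov : IsMarkovKernel toKernel
  firstMoment : ∃ x₀ : X, ∀ x, ∫⁻ y, edist x₀ y ∂(toKernel x) < ∞

attribute [instance] RandomWalk.isMarkov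

/-- The test random walks: `supp m_x` lies in the closed `ε`-ball around `x` for
`ρ`-almost every `x`. -/
def testWalks {X : Type*} [MetricSpace X] [MeasurableSpace X] (ε : ℝ) (ρ : Measure X) :
    Set (RandomWalk X) :=
  {m | ∀ᵐ x ∂ρ, (m.toKernel x).support ⊆ Metric.closedBall x ε}

/-- The nonlocal gradient. -/
def grad {X : Type*} (ε : ℝ) (u : X → ℝ) (x y : X) : ℝ := (u y - u x) / ε

/-- The random walk `n_x = (m⁰_x + m¹_x) / 2`. -/
def avgWalk {X : Type*} [MetricSpace X] [MeasurableSpace X] [BorelSpace X]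
    (m₀ m₁ : RandomWalk X) : RandomWalk X where
  toKernel :=
    { toFun := fun x => (2 : ℝ≥0∞)⁻¹ • (m₀.toKernel x + m₁.toKernel x)
      measurable' := by
        refine Measure.measurable_of_measurable_coe _ fun s hs => ?_
        simp only [Measure.smul_apply, Measure.add_apply, smul_eq_mul]
        exact ((m₀.toKernel.measurable_coe hs).add
          (m₁.toKernel.measurable_coe hs)).const_mul _ }
  isMarkov := ⟨fun x => ⟨by
    change ((2 : ℝ≥0∞)⁻¹ • (m₀.toKernel x + m₁.toKernel x)) univ = 1
    simp only [Measure.smul_apply, Measure.add_apply, measure_univ, smul_eq_mul]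
    rw [one_add_one_eq_two]
    exact ENNReal.inv_mul_cancel (by simp) (by simp)⟩⟩
  firstMoment := by
    obtain ⟨a, ha⟩ := m₀.firstMoment
    obtain ⟨b, hb⟩ := m₁.firstMoment
    refine ⟨a, fun x => ?_⟩
    change ∫⁻ y, edist a y ∂((2 : ℝ≥0∞)⁻¹ • (m₀.toKernel x + m₁.toKernel x)) < ∞
    rw [lintegral_smul_measure, lintegral_add_measure]
    refine ENNReal.mul_lt_top (by simp) (ENNReal.add_lt_top.2 ⟨ha x, ?_⟩)
    calc ∫⁻ y, edist a y ∂(m₁.toKernel x)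
        ≤ ∫⁻ y, (edist a b + edist b y) ∂(m₁.toKernel x) :=
          lintegral_mono fun y => edist_triangle a b y
      _ = edist a b + ∫⁻ y, edist b y ∂(m₁.toKernel x) := by
          rw [lintegral_add_left measurable_const]; simp
      _ < ∞ := ENNReal.add_lt_top.2 ⟨edist_lt_top a b, hb x⟩

/-- The jointly measurable density
`[m; ρ](x, y) = (dρ₀/dρ)(x) (dm⁰_x/dn_x)(y) - (dρ₁/dρ)(x) (dm¹_x/dn_x)(y)`. -/
def density {X : Type*} [MetricSpace X] [ProperSpace X] [MeasurableSpace X] [BorelSpace X]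
    (μ : Measure (X × Fin 2)) (m₀ m₁ : RandomWalk X) (x y : X) : ℝ :=
  ((classCond μ 0).rnDeriv (total μ) x).toReal
      * (Kernel.rnDeriv m₀.toKernel (avgWalk m₀ m₁).toKernel x y).toReal
    - ((classCond μ 1).rnDeriv (total μ) x).toReal
      * (Kernel.rnDeriv m₁.toKernel (avgWalk m₀ m₁).toKernel x y).toReal

/-- The nonlocal divergence of a random walk weighted by a finite measure; its values on Borel
sets are given by `walkDiv_apply`. -/
def walkDiv {X : Type*} [MetricSpace X] [MeasurableSpace X] (ε : ℝ) (ρ : Measure X)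
    [IsFiniteMeasure ρ] (m : RandomWalk X) : SignedMeasure X :=
  ε⁻¹ • (ρ.toSignedMeasure - (ρ.bind m.toKernel).toSignedMeasure)

theorem walkDiv_apply {X : Type*} [MetricSpace X] [MeasurableSpace X] (ε : ℝ) (ρ : Measure X)
    [IsFiniteMeasure ρ] (m : RandomWalk X) {A : Set X} (hA : MeasurableSet A) :
    walkDiv ε ρ m A =
      ((∫ x in A, (m.toKernel x).real univ ∂ρ) - ∫ x, (m.toKernel x).real A ∂ρ) / ε := by
  have h : (ρ.bind m.toKernel).real A = ∫ x, (m.toKernel x).real A ∂ρ := by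
    rw [Measure.real, Measure.bind_apply hA m.toKernel.measurable.aemeasurable]
    simp only [Measure.real]
    rw [integral_toReal (m.toKernel.measurable_coe hA).aemeasurable
      (Filter.Eventually.of_forall fun x => measure_lt_top _ _)]
  have h' : (∫ x in A, (m.toKernel x).real univ ∂ρ) = ρ.real A := by simp
  rw [← h, h', walkDiv, div_eq_inv_mul]
  simp [hA]

/-- The nonlocal divergence of a pair of random walks. -/
def pairDiv {X : Type*} [MetricSpace X] [MeasurableSpace X] (ε : ℝ) (μ : Measure (X × Fin 2))
    [IsFiniteMeasure μ] (m₀ m₁ : RandomWalk X) : SignedMeasure X :=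
  walkDiv ε (classCond μ 0) m₀ - walkDiv ε (classCond μ 1) m₁

end AdvTV

end

/-! All the formulas rest on one measurable selection: points `argmax x` and `argmin x` of the
closed `ε`-ball at which `u` is extremal, chosen measurably in `x` (`exists_measurable_argmin`,
bundled in `ExtremalMaps`). The integrands of `advTV` then become the gradients of `u` from `x` to
these points, both nonnegative because the centre competes. Averaging a gradient over a walk carried
by the ball cannot exceed its extremal value, and the Dirac walks at the selected points attain it;
this is `isGreatest_integral_grad`.

The density form follows because each `dm/dn` cancels against `n` (`integral_mul_density`), and the
divergence form because for bounded `u` it is the gradient form rewritten (`neg_integral_pairDiv`).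
The reference-measure formula is pointwise: the shrinking maps make the open ball dense in the
closed one, so essential extrema over open balls are true extrema over closed ones. -/

namespace AdvTV

/-! ### Measurable selection of minimizers -/

/-- Successive argmin sets: among the points of `F x`, keep those minimizing `f 0`, among these
those minimizing `f 1`, and so on. -/
def lexArgmin {X Y : Type*} (F : X → Set Y) (f : ℕ → Y → ℝ) : ℕ → X → Set Y
  | 0 => F
  | n + 1 => fun x =>
      {y ∈ lexArgmin F f n x | ∀ z ∈ lexArgmin F f n x, f n y ≤ f n z}

section Selection

variable {X Y : Type*} {F : X → Set Y} {f : ℕ → Y → ℝ}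

theorem lexArgmin_succ_subset (n : ℕ) (x : X) : lexArgmin F f (n + 1) x ⊆ lexArgmin F f n x :=
  fun _ hy => hy.1

theorem lexArgmin_isCompact_nonempty [TopologicalSpace Y]
    (hF : ∀ x, IsCompact (F x) ∧ (F x).Nonempty) (hf : ∀ n, Continuous (f n)) (n : ℕ) (x : X) :
    IsCompact (lexArgmin F f n x) ∧ (lexArgmin F f n x).Nonempty := by
  induction n with
  | zero => exact hF x
  | succ n ih =>
    obtain ⟨hc, hne⟩ := ih
    obtain ⟨y, hy, hmin⟩ := hc.exists_isMinOn hne (hf n).continuousOn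
    refine ⟨?_, y, hy, fun z hz => hmin hz⟩
    -- Once the minimum is attained at `y`, the argmin set is a sublevel set at the value `f n y`,
    -- hence closed.
    have : lexArgmin F f (n + 1) x = lexArgmin F f n x ∩ {w | f n w ≤ f n y} := by
      ext w
      exact ⟨fun hw => ⟨hw.1, hw.2 y hy⟩,
        fun hw => ⟨hw.1, fun z hz => le_trans hw.2 (hmin hz)⟩⟩
    rw [this]
    exact hc.inter_right (isClosed_le (hf n) continuous_const)

/-- The argmin set meets `C` iff the minimum over the part in `C` does not exceed the overall
minimum. By compactness this can be tested on rational levels: every sublevel set that meets the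
current set must meet it inside `C`. The induction needs all closed `C` at once. -/
theorem measurableSet_lexArgmin_inter_nonempty [MeasurableSpace X] [TopologicalSpace Y]
    (hF : ∀ x, IsCompact (F x) ∧ (F x).Nonempty)
    (hm : ∀ C, IsClosed C → MeasurableSet {x | (F x ∩ C).Nonempty})
    (hf : ∀ n, Continuous (f n)) (n : ℕ) {C : Set Y} (hC : IsClosed C) :
    MeasurableSet {x | (lexArgmin F f n x ∩ C).Nonempty} := by
  induction n generalizing C with
  | zero => exact hm C hC
  | succ n ih =>
    have key : {x | (lexArgmin F f (n + 1) x ∩ C).Nonempty} =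
        {x | (lexArgmin F f n x ∩ C).Nonempty} ∩
        ⋂ q : ℚ, ({x | (lexArgmin F f n x ∩ {y | f n y ≤ q}).Nonempty}ᶜ ∪
          {x | (lexArgmin F f n x ∩ (C ∩ {y | f n y ≤ q})).Nonempty}) := by
      ext x
      simp only [mem_inter_iff, mem_iInter, mem_union, mem_compl_iff, mem_ofPred_eq]
      constructor
      · rintro ⟨y, hy, hyC⟩
        refine ⟨⟨y, hy.1, hyC⟩, fun q => ?_⟩
        by_cases h : (lexArgmin F f n x ∩ {y | f n y ≤ q}).Nonempty
        · obtain ⟨z, hz, hzq⟩ := h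
          exact Or.inr ⟨y, hy.1, hyC, (hy.2 z hz).trans hzq⟩
        · exact Or.inl h
      · rintro ⟨hne, hq⟩
        obtain ⟨y, ⟨hy, hyC⟩, hmin⟩ :=
          ((lexArgmin_isCompact_nonempty hF hf n x).1.inter_right hC).exists_isMinOn hne
            (hf n).continuousOn
        refine ⟨y, ⟨hy, fun z hz => ?_⟩, hyC⟩
        by_contra! hlt
        obtain ⟨q, hq1, hq2⟩ := exists_rat_btwn hlt
        rcases hq q with h | ⟨w, hw, hwC, hwq⟩
        · exact h ⟨z, hz, hq1.le⟩
        · exact absurd ((hmin ⟨hw, hwC⟩ : f n y ≤ f n w).trans hwq) (not_le.2 hq2)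
    rw [key]
    refine (ih hC).inter (MeasurableSet.iInter fun q => ?_)
    have hq : IsClosed {y | f n y ≤ (q : ℝ)} := isClosed_le (hf n) continuous_const
    exact (ih hq).compl.union (ih (hC.inter hq))

/-- A compact-valued measurable correspondence has a measurable selection minimizing a given
continuous function. -/
theorem exists_measurable_argmin [MeasurableSpace X] [MetricSpace Y]
    [TopologicalSpace.SeparableSpace Y] [Nonempty Y] [MeasurableSpace Y] [BorelSpace Y]
    (hF : ∀ x, IsCompact (F x) ∧ (F x).Nonempty)
    (hm : ∀ C, IsClosed C → MeasurableSet {x | (F x ∩ C).Nonempty})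
    {g : Y → ℝ} (hg : Continuous g) :
    ∃ T : X → Y, Measurable T ∧ ∀ x, T x ∈ F x ∧ ∀ y ∈ F x, g (T x) ≤ g y := by
  -- Minimize `g` first, then break ties by the distances to a dense sequence; these distances
  -- determine a point, so exactly one point survives.
  let f : ℕ → Y → ℝ := fun n =>
    Nat.casesOn n g fun k y => dist y (TopologicalSpace.denseSeq Y k)
  have hf : ∀ n, Continuous (f n) := by
    rintro (_ | k)
    · exact hg
    · exact continuous_id.dist continuous_const
  have hK := lexArgmin_isCompact_nonempty hF hf
  have hinter : ∀ x (C : Set Y), IsClosed C → (∀ n, (lexArgmin F f n x ∩ C).Nonempty) →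
      (⋂ n, lexArgmin F f n x ∩ C).Nonempty := fun x C hC hne =>
    IsCompact.nonempty_iInter_of_sequence_nonempty_isCompact_isClosed _
      (fun n => inter_subset_inter_left _ (lexArgmin_succ_subset n x)) hne
      ((hK 0 x).1.inter_right hC) (fun n => (hK n x).1.isClosed.inter hC)
  have huniq : ∀ x y z, (∀ n, y ∈ lexArgmin F f n x) → (∀ n, z ∈ lexArgmin F f n x) → y = z := by
    intro x y z hy hz
    have hd : ∀ k, dist y (TopologicalSpace.denseSeq Y k) =
        dist z (TopologicalSpace.denseSeq Y k) := fun k =>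
      -- The distance to the `k`-th dense point is `f (k + 1)`, whose minimizers form stage `k + 2`.
      le_antisymm ((hy (k + 2)).2 z (hz (k + 1))) ((hz (k + 2)).2 y (hy (k + 1)))
    have : (fun w => dist y w) = fun w => dist z w :=
      (TopologicalSpace.denseRange_denseSeq Y).equalizer (by fun_prop) (by fun_prop) (funext hd)
    have := congrFun this z
    simpa using this
  have hex : ∀ x, ∃ y, ∀ n, y ∈ lexArgmin F f n x := fun x => by
    obtain ⟨y, hy⟩ := hinter x univ isClosed_univ (fun n => by simpa using (hK n x).2)
    exact ⟨y, fun n => (mem_iInter.1 hy n).1⟩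
  choose T hT using hex
  refine ⟨T, measurable_of_isClosed fun C hC => ?_, fun x => ⟨hT x 0, fun y hy => (hT x 1).2 y hy⟩⟩
  have : T ⁻¹' C = ⋂ n, {x | (lexArgmin F f n x ∩ C).Nonempty} := by
    ext x
    simp only [mem_preimage, mem_iInter, mem_ofPred_eq]
    refine ⟨fun h n => ⟨T x, hT x n, h⟩, fun h => ?_⟩
    obtain ⟨y, hy⟩ := hinter x C hC h
    rw [mem_iInter] at hy
    rw [huniq x (T x) y (hT x) fun n => (hy n).1]
    exact (hy 0).2
  rw [this]
  exact MeasurableSet.iInter fun n => measurableSet_lexArgmin_inter_nonempty hF hm hf n hC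

end Selection

/-- A continuous function on a proper space attains its maximum over the closed balls of a fixed
radius at points depending measurably on the centre. -/
theorem exists_measurable_argmax_closedBall {X : Type*} [MetricSpace X] [ProperSpace X]
    [MeasurableSpace X] [BorelSpace X] {ε : ℝ} (hε : 0 ≤ ε) {u : X → ℝ} (hu : Continuous u) :
    ∃ T : X → X, Measurable T ∧
      ∀ x, T x ∈ Metric.closedBall x ε ∧ ∀ y ∈ Metric.closedBall x ε, u y ≤ u (T x) := by
  cases isEmpty_or_nonempty X
  · exact ⟨id, measurable_id, fun x => isEmptyElim x⟩
  obtain ⟨T, hT, h⟩ := exists_measurable_argmin (F := fun x : X => Metric.closedBall x ε)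
    (fun x => ⟨isCompact_closedBall x ε, x, Metric.mem_closedBall_self hε⟩) (fun C hC => by
    -- In a proper space the infimal distance to a closed set is attained, so the centres whose ball
    -- meets `C` form the closed thickening of `C`.
    have : {x | (Metric.closedBall x ε ∩ C).Nonempty} = Metric.cthickening ε C := by
      ext x
      rw [hC.cthickening_eq_biUnion_closedBall hε]
      simp only [mem_ofPred_eq, mem_iUnion, Set.Nonempty, mem_inter_iff, Metric.mem_closedBall,
        exists_prop, dist_comm x]
      exact exists_congr fun y => and_comm
    rw [this]
    exact Metric.isClosed_cthickening.measurableSet) hu.neg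
  exact ⟨T, hT, fun x => ⟨(h x).1, fun y hy => neg_le_neg_iff.1 ((h x).2 y hy)⟩⟩

/-! ### Extended-valued integrals -/

section ExtIntegral

variable {X : Type*} [MeasurableSpace X] {ρ : Measure X} {f g : X → ℝ}

/-- Positive and negative parts are compared separately, so neither measurability nor integrability
enters, and `⊤ - ⊤ = ⊥` respects the order. -/
theorem extIntegral_mono_ae (h : f ≤ᵐ[ρ] g) : extIntegral ρ f ≤ extIntegral ρ g := by
  unfold extIntegral
  refine EReal.sub_le_sub ?_ ?_
  · refine EReal.coe_ennreal_le_coe_ennreal_iff.2 (lintegral_mono_ae ?_)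
    filter_upwards [h] with x hx using ENNReal.ofReal_le_ofReal hx
  · refine EReal.coe_ennreal_le_coe_ennreal_iff.2 (lintegral_mono_ae ?_)
    filter_upwards [h] with x hx using ENNReal.ofReal_le_ofReal (neg_le_neg hx)

theorem extIntegral_congr_ae (h : f =ᵐ[ρ] g) : extIntegral ρ f = extIntegral ρ g :=
  le_antisymm (extIntegral_mono_ae h.le) (extIntegral_mono_ae h.symm.le)

theorem extIntegral_of_nonneg (h : ∀ x, 0 ≤ f x) :
    extIntegral ρ f = ((∫⁻ x, ENNReal.ofReal (f x) ∂ρ : ℝ≥0∞) : EReal) := by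
  have : ∀ x, ENNReal.ofReal (-f x) = 0 := fun x =>
    ENNReal.ofReal_of_nonpos (neg_nonpos.2 (h x))
  simp [extIntegral, this]

theorem extIntegral_of_integrable (h : Integrable f ρ) :
    extIntegral ρ f = ((∫ x, f x ∂ρ : ℝ) : EReal) := by
  have h1 : ∫⁻ x, ENNReal.ofReal (f x) ∂ρ ≠ ∞ := h.lintegral_lt_top.ne
  have h2 : ∫⁻ x, ENNReal.ofReal (-f x) ∂ρ ≠ ∞ := h.neg.lintegral_lt_top.ne
  rw [extIntegral, integral_eq_lintegral_pos_part_sub_lintegral_neg_part h, EReal.coe_sub,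
    EReal.coe_ennreal_toReal h1, EReal.coe_ennreal_toReal h2]

end ExtIntegral

/-! ### Essential extrema over open balls -/

section Reference

variable {X : Type*} [MetricSpace X] [MeasurableSpace X] {ε : ℝ}

/-- For small `r`, the map with parameter `r` moves `y` by at most `r` into a ball of radius `ε -
r`, hence into the open ball. -/
theorem ShrinkingMaps.closedBall_subset_closure_ball (hε : 0 < ε) (hT : ShrinkingMaps X ε)
    (x : X) : Metric.closedBall x ε ⊆ closure (Metric.ball x ε) := by
  intro y hy
  rw [Metric.mem_closure_iff]
  intro δ hδ
  have hr : 0 < min (δ / 2) (ε / 2) := lt_min (half_pos hδ) (half_pos hε)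
  obtain ⟨T, -, hd⟩ := hT x (min (δ / 2) (ε / 2)) hr
    ((min_le_right _ _).trans_lt (half_lt_self hε))
  refine ⟨T ⟨y, hy⟩, ?_, ?_⟩
  · exact lt_of_le_of_lt (Metric.mem_closedBall.1 (T ⟨y, hy⟩).2) (by linarith)
  · rw [dist_comm]
    exact (hd ⟨y, hy⟩).trans_lt ((min_le_left _ _).trans_lt (half_lt_self hδ))

theorem IsReferenceMeasure.ae_ball_subset_support [SecondCountableTopology X]
    {μ : Measure (X × Fin 2)} {ν : Measure X} (h : IsReferenceMeasure ε μ ν) (i : Fin 2) :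
    ∀ᵐ x ∂(classCond μ i), Metric.ball x ε ⊆ ν.support := by
  filter_upwards [Measure.support_mem_ae (μ := classCond μ i)] with x hx y hy
  refine h.support_subset i (Metric.mem_cthickening_of_dist_le y x ε _ hx ?_)
  exact (Metric.mem_ball.1 hy).le

variable [BorelSpace X] {ν : Measure X} {u : X → ℝ} {x z : X}

/-- If the ball lies in the support of `ν` and the maximum of `u` over the closed ball is attained
at a point of the closure of the open ball, then the essential upper bounds of `u` on the open
ball are the numbers above this maximum. -/
theorem ae_restrict_ball_le_iff (hu : Continuous u) (hν : Metric.ball x ε ⊆ ν.support)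
    (hz : z ∈ closure (Metric.ball x ε)) (hmax : ∀ y ∈ Metric.closedBall x ε, u y ≤ u z) {a : ℝ} :
    (∀ᵐ y ∂(ν.restrict (Metric.ball x ε)), u y ≤ a) ↔ u z ≤ a := by
  constructor
  · intro h
    by_contra! hlt
    have hopen : IsOpen {y | a < u y} := isOpen_lt continuous_const hu
    -- A strict excess at `z` spreads to an open set meeting the ball, and there `ν` has positive
    -- mass.
    obtain ⟨y, hya, hyb⟩ := mem_closure_iff.1 hz _ hopen hlt
    have hpos : 0 < ν ({y | a < u y} ∩ Metric.ball x ε) :=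
      (Measure.mem_support_iff_forall y).1 (hν hyb) _
        ((hopen.inter Metric.isOpen_ball).mem_nhds ⟨hya, hyb⟩)
    rw [ae_iff, Measure.restrict_apply (by simpa using hopen.measurableSet)] at h
    simp only [not_le] at h
    exact hpos.ne' h
  · intro h
    filter_upwards [ae_restrict_mem Metric.isOpen_ball.measurableSet] with y hy
    exact (hmax y (Metric.ball_subset_closedBall hy)).trans h

theorem essSup_restrict_ball (hu : Continuous u) (hν : Metric.ball x ε ⊆ ν.support)
    (hz : z ∈ closure (Metric.ball x ε)) (hmax : ∀ y ∈ Metric.closedBall x ε, u y ≤ u z) :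
    essSup u (ν.restrict (Metric.ball x ε)) = u z := by
  rw [essSup, Filter.limsup_eq]
  -- The essential upper bounds are exactly `Ici (u z)`, so the real infimum takes no default value.
  simp only [ae_restrict_ball_le_iff hu hν hz hmax]
  exact csInf_Ici

theorem essInf_restrict_ball (hu : Continuous u) (hν : Metric.ball x ε ⊆ ν.support)
    (hz : z ∈ closure (Metric.ball x ε)) (hmin : ∀ y ∈ Metric.closedBall x ε, u z ≤ u y) :
    essInf u (ν.restrict (Metric.ball x ε)) = u z := by
  have h (a : ℝ) : (∀ᵐ y ∂(ν.restrict (Metric.ball x ε)), a ≤ u y) ↔ a ≤ u z := by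
    simpa only [Pi.neg_apply, neg_le_neg_iff] using
      ae_restrict_ball_le_iff hu.neg hν hz (fun y hy => neg_le_neg (hmin y hy)) (a := -a)
  rw [essInf, Filter.liminf_eq]
  simp only [h]
  exact csSup_Iic

end Reference

/-! ### Random walks and their densities -/

section Walk

variable {X : Type*} [MetricSpace X] [MeasurableSpace X]

/-- The deterministic random walk jumping from `x` to `T x`. -/
noncomputable def diracWalk [BorelSpace X] (T : X → X) (hT : Measurable T) (x₀ : X) :
    RandomWalk X where
  toKernel := Kernel.deterministic T hT
  isMarkov := inferInstance
  firstMoment := ⟨x₀, fun x => by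
    rw [Kernel.deterministic_apply, lintegral_dirac]
    exact edist_lt_top _ _⟩

theorem integral_diracWalk [BorelSpace X] {T : X → X} (hT : Measurable T) (x₀ x : X)
    (f : X → ℝ) : ∫ y, f y ∂((diracWalk T hT x₀).toKernel x) = f (T x) := by
  simp [diracWalk, Kernel.deterministic_apply]

theorem diracWalk_mem_testWalks [BorelSpace X] {T : X → X} (hT : Measurable T) (x₀ : X) {ε : ℝ}
    (h : ∀ x, T x ∈ Metric.closedBall x ε) (ρ : Measure X) :
    diracWalk T hT x₀ ∈ testWalks ε ρ := by
  refine mem_ofPred_eq ▸ Filter.Eventually.of_forall fun x => ?_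
  refine Measure.support_subset_of_isClosed Metric.isClosed_closedBall ?_
  change Metric.closedBall x ε ∈ ae (Measure.dirac (T x))
  rw [ae_dirac_eq]
  exact h x

theorem ae_mem_closedBall_of_mem_testWalks [SecondCountableTopology X] {ε : ℝ} {ρ : Measure X}
    {m : RandomWalk X} (hm : m ∈ testWalks ε ρ) :
    ∀ᵐ x ∂ρ, ∀ᵐ y ∂(m.toKernel x), y ∈ Metric.closedBall x ε := by
  filter_upwards [hm] with x hx
  filter_upwards [Measure.support_mem_ae (μ := m.toKernel x)] with y hy using hx hy

variable [BorelSpace X]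

theorem absolutelyContinuous_avgWalk_left (m₀ m₁ : RandomWalk X) (x : X) :
    m₀.toKernel x ≪ (avgWalk m₀ m₁).toKernel x :=
  (Measure.AbsolutelyContinuous.rfl.add_right _).trans
    (Measure.absolutelyContinuous_smul (by simp))

theorem absolutelyContinuous_avgWalk_right (m₀ m₁ : RandomWalk X) (x : X) :
    m₁.toKernel x ≪ (avgWalk m₀ m₁).toKernel x :=
  (Measure.AbsolutelyContinuous.rfl.add_right' _).trans
    (Measure.absolutelyContinuous_smul (by simp))

variable [ProperSpace X]

theorem integrable_of_ae_mem_closedBall {κ : Measure X} [IsFiniteMeasure κ] {x : X} {ε : ℝ}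
    {f : X → ℝ} (hf : Continuous f) (h : ∀ᵐ y ∂κ, y ∈ Metric.closedBall x ε) :
    Integrable f κ := by
  obtain ⟨C, hC⟩ := (isCompact_closedBall x ε).exists_bound_of_continuousOn hf.continuousOn
  exact Integrable.of_bound hf.aestronglyMeasurable C (h.mono fun y hy => hC y hy)

theorem integral_le_of_ae_mem_closedBall {κ : Measure X} [IsProbabilityMeasure κ] {x : X} {ε c : ℝ}
    {f : X → ℝ} (hf : Continuous f) (h : ∀ᵐ y ∂κ, y ∈ Metric.closedBall x ε)
    (hle : ∀ y ∈ Metric.closedBall x ε, f y ≤ c) : ∫ y, f y ∂κ ≤ c := by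
  calc ∫ y, f y ∂κ ≤ ∫ _, c ∂κ :=
        integral_mono_ae (integrable_of_ae_mem_closedBall hf h) (integrable_const c)
          (h.mono fun y hy => hle y hy)
    _ = c := by simp

theorem integral_mul_kernel_rnDeriv {κ η : Kernel X X} [IsFiniteKernel κ] [IsFiniteKernel η]
    {x : X} (h : κ x ≪ η x) (f : X → ℝ) :
    ∫ y, f y * (Kernel.rnDeriv κ η x y).toReal ∂(η x) = ∫ y, f y ∂(κ x) := by
  rw [← integral_rnDeriv_smul h]
  refine integral_congr_ae ?_
  filter_upwards [Kernel.rnDeriv_eq_rnDeriv_measure (κ := κ) (η := η) (a := x)] with y hy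
  rw [hy, smul_eq_mul, mul_comm]

theorem integrable_mul_kernel_rnDeriv {κ η : Kernel X X} [IsFiniteKernel κ] [IsFiniteKernel η]
    {x : X} (h : κ x ≪ η x) {f : X → ℝ} (hf : Integrable f (κ x)) :
    Integrable (fun y => f y * (Kernel.rnDeriv κ η x y).toReal) (η x) := by
  refine ((integrable_rnDeriv_smul_iff h).2 hf).congr ?_
  filter_upwards [Kernel.rnDeriv_eq_rnDeriv_measure (κ := κ) (η := η) (a := x)] with y hy
  rw [hy, smul_eq_mul, mul_comm]

/-- Each walk is absolutely continuous with respect to the average, so its derivative converts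
integration against the average back into integration against the walk. Integrability of `f` permits
splitting the difference. -/
theorem integral_mul_density (μ : Measure (X × Fin 2)) (m₀ m₁ : RandomWalk X) {x : X} {f : X → ℝ}
    (h₀ : Integrable f (m₀.toKernel x)) (h₁ : Integrable f (m₁.toKernel x)) :
    ∫ y, f y * density μ m₀ m₁ x y ∂((avgWalk m₀ m₁).toKernel x) =
      ((classCond μ 0).rnDeriv (total μ) x).toReal * ∫ y, f y ∂(m₀.toKernel x) +
      ((classCond μ 1).rnDeriv (total μ) x).toReal * ∫ y, -f y ∂(m₁.toKernel x) := by
  have a₀ := absolutelyContinuous_avgWalk_left m₀ m₁ x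
  have a₁ := absolutelyContinuous_avgWalk_right m₀ m₁ x
  simp only [density, mul_sub, mul_left_comm (f _)]
  rw [integral_sub ((integrable_mul_kernel_rnDeriv a₀ h₀).const_mul _)
    ((integrable_mul_kernel_rnDeriv a₁ h₁).const_mul _), integral_const_mul, integral_const_mul,
    integral_mul_kernel_rnDeriv a₀, integral_mul_kernel_rnDeriv a₁, integral_neg]
  ring

end Walk

/-- Nonnegativity excludes cancelling infinities, so the identity reduces to additivity of the lower
integral and the change of density; the derivatives are a.e. finite, so `toReal` loses nothing. -/
theorem extIntegral_rnDeriv_mul_add {X : Type*} [MeasurableSpace X] {ρ₀ ρ₁ ρ : Measure X}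
    [IsFiniteMeasure ρ₀] [IsFiniteMeasure ρ₁] [IsFiniteMeasure ρ] (h₀ : ρ₀ ≪ ρ) (h₁ : ρ₁ ≪ ρ)
    {f g : X → ℝ} (hf : Measurable f) (hg : Measurable g) (hf0 : ∀ x, 0 ≤ f x)
    (hg0 : ∀ x, 0 ≤ g x) :
    extIntegral ρ (fun x => (ρ₀.rnDeriv ρ x).toReal * f x + (ρ₁.rnDeriv ρ x).toReal * g x) =
      extIntegral ρ₀ f + extIntegral ρ₁ g := by
  rw [extIntegral_of_nonneg hf0, extIntegral_of_nonneg hg0, extIntegral_of_nonneg fun x =>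
    add_nonneg (mul_nonneg ENNReal.toReal_nonneg (hf0 x))
      (mul_nonneg ENNReal.toReal_nonneg (hg0 x)), ← EReal.coe_ennreal_add,
    ← lintegral_rnDeriv_mul h₀ hf.ennreal_ofReal.aemeasurable,
    ← lintegral_rnDeriv_mul h₁ hg.ennreal_ofReal.aemeasurable,
    ← lintegral_add_left ((Measure.measurable_rnDeriv ρ₀ ρ).fun_mul hf.ennreal_ofReal)]
  congr 1
  refine lintegral_congr_ae ?_
  filter_upwards [ρ₀.rnDeriv_ne_top ρ, ρ₁.rnDeriv_ne_top ρ] with x hx₀ hx₁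
  rw [ENNReal.ofReal_add (mul_nonneg ENNReal.toReal_nonneg (hf0 x))
      (mul_nonneg ENNReal.toReal_nonneg (hg0 x)), ENNReal.ofReal_mul ENNReal.toReal_nonneg,
    ENNReal.ofReal_mul ENNReal.toReal_nonneg, ENNReal.ofReal_toReal hx₀,
    ENNReal.ofReal_toReal hx₁]

theorem integral_grad {X : Type*} [MeasurableSpace X] (ε : ℝ) (κ : Measure X) [IsProbabilityMeasure κ]
    {u : X → ℝ} (hu : Integrable u κ) (x : X) : ∫ y, grad ε u x y ∂κ = (∫ y, u y ∂κ - u x) / ε := by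
  simp only [grad]
  rw [integral_div, integral_sub hu (integrable_const _)]
  simp

/-! ### Integration against the divergence -/

section Divergence

variable {X : Type*} [MetricSpace X] [MeasurableSpace X] [BorelSpace X]

theorem integrable_boundedContinuousFunction_variation [SecondCountableTopology X]
    (ρ : Measure X) [IsFiniteMeasure ρ] (u : X →ᵇ ℝ) :
    ρ.toSignedMeasure.Integrable u := by
  rw [VectorMeasure.Integrable, Measure.variation_toSignedMeasure]
  exact u.integrable ρ

theorem integrable_walkDiv [SecondCountableTopology X] (ε : ℝ) (ρ : Measure X)
    [IsFiniteMeasure ρ] (m : RandomWalk X) (u : X →ᵇ ℝ) : (walkDiv ε ρ m).Integrable u :=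
  ((integrable_boundedContinuousFunction_variation ρ u).sub_vectorMeasure
    (integrable_boundedContinuousFunction_variation _ u)).smul_vectorMeasure _

theorem integral_bind_boundedContinuousFunction [SecondCountableTopology X] (ρ : Measure X)
    [IsFiniteMeasure ρ] (κ : Kernel X X) [IsMarkovKernel κ] (u : X →ᵇ ℝ) :
    Integrable (fun x => ∫ y, u y ∂(κ x)) ρ ∧
      ∫ y, u y ∂(ρ.bind κ) = ∫ x, ∫ y, u y ∂(κ x) ∂ρ := by
  have h : Integrable u ((κ ∘ₖ Kernel.const Unit ρ) ()) := u.integrable _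
  refine ⟨by simpa using h.integral_comp, ?_⟩
  rw [Measure.comp_eq_comp_const_apply, Kernel.integral_comp h, Kernel.const_apply]

theorem integrable_integral_grad [SecondCountableTopology X] (ε : ℝ) (ρ : Measure X)
    [IsFiniteMeasure ρ] (m : RandomWalk X) (u : X →ᵇ ℝ) :
    Integrable (fun x => ∫ y, grad ε u x y ∂(m.toKernel x)) ρ := by
  simp only [fun x => integral_grad ε (m.toKernel x) (u.integrable _) x]
  exact ((integral_bind_boundedContinuousFunction ρ m.toKernel u).1.sub (u.integrable ρ)).div_const _

theorem integral_walkDiv [SecondCountableTopology X] (ε : ℝ) (ρ : Measure X) [IsFiniteMeasure ρ]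
    (m : RandomWalk X) (u : X →ᵇ ℝ) :
    ∫ᵛ x, u x ∂<•(walkDiv ε ρ m) = -∫ x, ∫ y, grad ε u x y ∂(m.toKernel x) ∂ρ := by
  obtain ⟨hi, he⟩ := integral_bind_boundedContinuousFunction ρ m.toKernel u
  rw [walkDiv, VectorMeasure.integral_smul_vectorMeasure,
    VectorMeasure.integral_sub_vectorMeasure (integrable_boundedContinuousFunction_variation ρ u)
      (integrable_boundedContinuousFunction_variation _ u),
    VectorMeasure.integral_toSignedMeasure, VectorMeasure.integral_toSignedMeasure, he]
  simp only [fun x => integral_grad ε (m.toKernel x) (u.integrable _) x]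
  rw [integral_div, integral_sub hi (u.integrable ρ), smul_eq_mul, div_eq_inv_mul]
  ring

/-- Boundedness of `u` makes every term integrable, so the extended integrals are ordinary ones and
the two divergence identities can be subtracted. -/
theorem neg_integral_pairDiv [SecondCountableTopology X] (ε : ℝ) (μ : Measure (X × Fin 2))
    [IsFiniteMeasure μ] (m₀ m₁ : RandomWalk X) (u : X →ᵇ ℝ) :
    ((-(∫ᵛ x, u x ∂<•(pairDiv ε μ m₀ m₁)) : ℝ) : EReal) =
      extIntegral (classCond μ 0) (fun x => ∫ y, grad ε u x y ∂(m₀.toKernel x)) +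
        extIntegral (classCond μ 1) (fun x => ∫ y, -grad ε u x y ∂(m₁.toKernel x)) := by
  simp only [integral_neg]
  rw [extIntegral_of_integrable (integrable_integral_grad ε _ m₀ u),
    extIntegral_of_integrable (integrable_integral_grad ε _ m₁ u).fun_neg, ← EReal.coe_add, pairDiv,
    VectorMeasure.integral_sub_vectorMeasure (integrable_walkDiv ε _ m₀ u)
      (integrable_walkDiv ε _ m₁ u), integral_walkDiv, integral_walkDiv, integral_neg]
  congr 1
  ring

end Divergence

/-! ### Extremal maps and attainment of the maxima -/

/-- Measurable selections of maximizers and minimizers of `u` over the closed `ε`-balls. -/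
structure ExtremalMaps {X : Type*} [MetricSpace X] [MeasurableSpace X] (ε : ℝ) (u : X → ℝ) where
  argmax : X → X
  argmin : X → X
  measurable_argmax : Measurable argmax
  measurable_argmin : Measurable argmin
  argmax_mem : ∀ x, argmax x ∈ Metric.closedBall x ε
  argmin_mem : ∀ x, argmin x ∈ Metric.closedBall x ε
  le_argmax : ∀ x, ∀ y ∈ Metric.closedBall x ε, u y ≤ u (argmax x)
  argmin_le : ∀ x, ∀ y ∈ Metric.closedBall x ε, u (argmin x) ≤ u y

theorem nonempty_extremalMaps {X : Type*} [MetricSpace X] [ProperSpace X] [MeasurableSpace X]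
    [BorelSpace X] {ε : ℝ} (hε : 0 ≤ ε) {u : X → ℝ} (hu : Continuous u) :
    Nonempty (ExtremalMaps ε u) := by
  obtain ⟨T, hT, h⟩ := exists_measurable_argmax_closedBall hε hu
  obtain ⟨S, hS, h'⟩ := exists_measurable_argmax_closedBall hε hu.neg
  exact ⟨⟨T, S, hT, hS, fun x => (h x).1, fun x => (h' x).1, fun x => (h x).2,
    fun x y hy => neg_le_neg_iff.1 ((h' x).2 y hy)⟩⟩

namespace ExtremalMaps

variable {X : Type*} [MetricSpace X] [MeasurableSpace X] {ε : ℝ} {u : X → ℝ}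

theorem advTV_eq (E : ExtremalMaps ε u) (μ : Measure (X × Fin 2)) : advTV ε μ u =
    extIntegral (classCond μ 0) (fun x => grad ε u x (E.argmax x)) +
      extIntegral (classCond μ 1) (fun x => -grad ε u x (E.argmin x)) := by
  have hmax (x : X) : sSup (u '' Metric.closedBall x ε) = u (E.argmax x) :=
    IsGreatest.csSup_eq ⟨mem_image_of_mem u (E.argmax_mem x),
      forall_mem_image.2 (E.le_argmax x)⟩
  have hmin (x : X) : sInf (u '' Metric.closedBall x ε) = u (E.argmin x) :=
    IsLeast.csInf_eq ⟨mem_image_of_mem u (E.argmin_mem x),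
      forall_mem_image.2 (E.argmin_le x)⟩
  simp only [advTV, hmax, hmin, grad, ← neg_div, neg_sub]

theorem grad_le (E : ExtremalMaps ε u) (hε : 0 < ε) (x : X) {y : X}
    (hy : y ∈ Metric.closedBall x ε) :
    grad ε u x y ≤ grad ε u x (E.argmax x) := by
  have := E.le_argmax x y hy
  unfold grad
  gcongr

theorem neg_grad_le (E : ExtremalMaps ε u) (hε : 0 < ε) (x : X) {y : X}
    (hy : y ∈ Metric.closedBall x ε) :
    -grad ε u x y ≤ -grad ε u x (E.argmin x) := by
  have := E.argmin_le x y hy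
  unfold grad
  gcongr

theorem grad_argmax_nonneg (E : ExtremalMaps ε u) (hε : 0 < ε) (x : X) : 0 ≤ grad ε u x (E.argmax x) := by
  simpa [grad] using E.grad_le hε x (Metric.mem_closedBall_self hε.le)

theorem neg_grad_argmin_nonneg (E : ExtremalMaps ε u) (hε : 0 < ε) (x : X) :
    0 ≤ -grad ε u x (E.argmin x) := by
  simpa [grad] using E.neg_grad_le hε x (Metric.mem_closedBall_self hε.le)

variable [BorelSpace X]

theorem refTV_eq_advTV (E : ExtremalMaps ε u) [SecondCountableTopology X] (hε : 0 < ε)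
    (hT : ShrinkingMaps X ε)
    (hu : Continuous u) {μ : Measure (X × Fin 2)} {ν : Measure X}
    (hν : IsReferenceMeasure ε μ ν) : refTV ε μ ν u = advTV ε μ u := by
  rw [E.advTV_eq, refTV]
  congr 1
  · refine extIntegral_congr_ae ?_
    filter_upwards [hν.ae_ball_subset_support 0] with x hx
    rw [essSup_restrict_ball hu hx (hT.closedBall_subset_closure_ball hε x (E.argmax_mem x))
      (E.le_argmax x), grad]
  · refine extIntegral_congr_ae ?_
    filter_upwards [hν.ae_ball_subset_support 1] with x hx
    rw [essInf_restrict_ball hu hx (hT.closedBall_subset_closure_ball hε x (E.argmin_mem x))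
      (E.argmin_le x), grad, ← neg_div, neg_sub]

variable [ProperSpace X]

theorem ae_integral_grad_le (E : ExtremalMaps ε u) (hε : 0 < ε) (hu : Continuous u)
    {ρ : Measure X} {m : RandomWalk X} (hm : m ∈ testWalks ε ρ) :
    ∀ᵐ x ∂ρ, ∫ y, grad ε u x y ∂(m.toKernel x) ≤ grad ε u x (E.argmax x) := by
  filter_upwards [ae_mem_closedBall_of_mem_testWalks hm] with x hx
  exact integral_le_of_ae_mem_closedBall ((hu.sub continuous_const).div_const ε) hx
    fun y hy => E.grad_le hε x hy

theorem ae_integral_neg_grad_le (E : ExtremalMaps ε u) (hε : 0 < ε) (hu : Continuous u)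
    {ρ : Measure X} {m : RandomWalk X} (hm : m ∈ testWalks ε ρ) :
    ∀ᵐ x ∂ρ, ∫ y, -grad ε u x y ∂(m.toKernel x) ≤ -grad ε u x (E.argmin x) := by
  filter_upwards [ae_mem_closedBall_of_mem_testWalks hm] with x hx
  exact integral_le_of_ae_mem_closedBall ((hu.sub continuous_const).div_const ε).neg hx
    fun y hy => E.neg_grad_le hε x hy

theorem isGreatest_integral_grad (E : ExtremalMaps ε u) (hε : 0 < ε) (hu : Continuous u)
    [Nonempty X] (μ : Measure (X × Fin 2)) :
    IsGreatest
      ((fun m : RandomWalk X × RandomWalk X =>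
          extIntegral (classCond μ 0) (fun x => ∫ y, grad ε u x y ∂(m.1.toKernel x))
            + extIntegral (classCond μ 1) (fun x => ∫ y, -grad ε u x y ∂(m.2.toKernel x))) ''
        (testWalks ε (total μ) ×ˢ testWalks ε (total μ)))
      (advTV ε μ u) := by
  obtain ⟨x₀⟩ := ‹Nonempty X›
  rw [E.advTV_eq]
  refine ⟨⟨(diracWalk _ E.measurable_argmax x₀, diracWalk _ E.measurable_argmin x₀),
    ⟨diracWalk_mem_testWalks _ x₀ E.argmax_mem _, diracWalk_mem_testWalks _ x₀ E.argmin_mem _⟩,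
    ?_⟩, ?_⟩
  · simp only [integral_diracWalk]
  · rintro _ ⟨⟨m₀, m₁⟩, ⟨h₀, h₁⟩, rfl⟩
    exact add_le_add
      (extIntegral_mono_ae (ae_add_measure_iff.1 (E.ae_integral_grad_le hε hu h₀)).1)
      (extIntegral_mono_ae (ae_add_measure_iff.1 (E.ae_integral_neg_grad_le hε hu h₁)).2)

theorem ae_integral_grad_mul_density (hu : Continuous u) (μ : Measure (X × Fin 2))
    {m₀ m₁ : RandomWalk X} (h₀ : m₀ ∈ testWalks ε (total μ)) (h₁ : m₁ ∈ testWalks ε (total μ)) :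
    ∀ᵐ x ∂(total μ),
      ∫ y, grad ε u x y * density μ m₀ m₁ x y ∂((avgWalk m₀ m₁).toKernel x) =
        ((classCond μ 0).rnDeriv (total μ) x).toReal * ∫ y, grad ε u x y ∂(m₀.toKernel x) +
        ((classCond μ 1).rnDeriv (total μ) x).toReal * ∫ y, -grad ε u x y ∂(m₁.toKernel x) := by
  filter_upwards [ae_mem_closedBall_of_mem_testWalks h₀,
    ae_mem_closedBall_of_mem_testWalks h₁] with x hx₀ hx₁
  have hc : Continuous (grad ε u x) := (hu.sub continuous_const).div_const ε
  exact integral_mul_density μ m₀ m₁ (integrable_of_ae_mem_closedBall hc hx₀)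
    (integrable_of_ae_mem_closedBall hc hx₁)

theorem isGreatest_integral_density (E : ExtremalMaps ε u) (hε : 0 < ε) (hu : Continuous u)
    [Nonempty X] (μ : Measure (X × Fin 2)) [IsFiniteMeasure μ] :
    IsGreatest
      ((fun m : RandomWalk X × RandomWalk X =>
          extIntegral (total μ)
            (fun x => ∫ y, grad ε u x y * density μ m.1 m.2 x y
              ∂((avgWalk m.1 m.2).toKernel x))) ''
        (testWalks ε (total μ) ×ˢ testWalks ε (total μ)))
      (advTV ε μ u) := by
  obtain ⟨x₀⟩ := ‹Nonempty X›
  have : IsFiniteMeasure (total μ) := inferInstanceAs (IsFiniteMeasure (_ + _))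
  have hmax : Measurable fun x => grad ε u x (E.argmax x) :=
    ((hu.measurable.comp E.measurable_argmax).sub hu.measurable).div_const ε
  have hmin : Measurable fun x => -grad ε u x (E.argmin x) :=
    (((hu.measurable.comp E.measurable_argmin).sub hu.measurable).div_const ε).neg
  have hac₀ : classCond μ 0 ≪ total μ := Measure.AbsolutelyContinuous.rfl.add_right _
  have hac₁ : classCond μ 1 ≪ total μ := Measure.AbsolutelyContinuous.rfl.add_right' _
  -- The target is written as one integral over `total μ`, so competitors are compared pointwise
  -- under it. Their own integrals need not split, since their integrands have no sign.
  rw [E.advTV_eq, ← extIntegral_rnDeriv_mul_add hac₀ hac₁ hmax hmin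
    (E.grad_argmax_nonneg hε) (E.neg_grad_argmin_nonneg hε)]
  have h₀ := diracWalk_mem_testWalks E.measurable_argmax x₀ E.argmax_mem (total μ)
  have h₁ := diracWalk_mem_testWalks E.measurable_argmin x₀ E.argmin_mem (total μ)
  refine ⟨⟨(diracWalk _ E.measurable_argmax x₀, diracWalk _ E.measurable_argmin x₀),
    ⟨h₀, h₁⟩, ?_⟩, ?_⟩
  · refine extIntegral_congr_ae ?_
    filter_upwards [ae_integral_grad_mul_density hu μ h₀ h₁] with x hx
    rw [hx, integral_diracWalk, integral_diracWalk]
  · rintro _ ⟨⟨m₀, m₁⟩, ⟨h₀, h₁⟩, rfl⟩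
    refine extIntegral_mono_ae ?_
    filter_upwards [ae_integral_grad_mul_density hu μ h₀ h₁, E.ae_integral_grad_le hε hu h₀,
      E.ae_integral_neg_grad_le hε hu h₁] with x hx hx₀ hx₁
    rw [hx]
    gcongr

end ExtremalMaps

end AdvTV

theorem mainTheorem1 {X : Type*} [MetricSpace X] [ProperSpace X] [MeasurableSpace X]
    [BorelSpace X] (ε : ℝ) (hε : 0 < ε) (hT : AdvTV.ShrinkingMaps X ε)
    (μ : Measure (X × Fin 2)) [IsProbabilityMeasure μ] :
    (∀ u : C(X, ℝ),
      (∀ ν : Measure X, AdvTV.IsReferenceMeasure ε μ ν →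
        AdvTV.refTV ε μ ν u = AdvTV.advTV ε μ u) ∧
      IsGreatest
        ((fun m : AdvTV.RandomWalk X × AdvTV.RandomWalk X =>
            AdvTV.extIntegral (AdvTV.classCond μ 0)
                (fun x => ∫ y, AdvTV.grad ε u x y ∂(m.1.toKernel x))
              + AdvTV.extIntegral (AdvTV.classCond μ 1)
                (fun x => ∫ y, -AdvTV.grad ε u x y ∂(m.2.toKernel x))) ''
          (AdvTV.testWalks ε (AdvTV.total μ) ×ˢ AdvTV.testWalks ε (AdvTV.total μ)))
        (AdvTV.advTV ε μ u) ∧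
      IsGreatest
        ((fun m : AdvTV.RandomWalk X × AdvTV.RandomWalk X =>
            AdvTV.extIntegral (AdvTV.total μ)
              (fun x => ∫ y, AdvTV.grad ε u x y * AdvTV.density μ m.1 m.2 x y
                ∂((AdvTV.avgWalk m.1 m.2).toKernel x))) ''
          (AdvTV.testWalks ε (AdvTV.total μ) ×ˢ AdvTV.testWalks ε (AdvTV.total μ)))
        (AdvTV.advTV ε μ u)) ∧
    ∀ u : X →ᵇ ℝ,
      IsGreatest
        ((fun m : AdvTV.RandomWalk X × AdvTV.RandomWalk X =>
            ((-(∫ᵛ x, u x ∂<•(AdvTV.pairDiv ε μ m.1 m.2)) : ℝ) : EReal)) ''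
          (AdvTV.testWalks ε (AdvTV.total μ) ×ˢ AdvTV.testWalks ε (AdvTV.total μ)))
        (AdvTV.advTV ε μ u) := by
  -- The Dirac walks need a base point for their first moment.
  obtain ⟨x₀, -⟩ : Nonempty (X × Fin 2) := nonempty_of_isProbabilityMeasure μ
  have : Nonempty X := ⟨x₀⟩
  refine ⟨fun u => ?_, fun u => ?_⟩
  · obtain ⟨E⟩ := AdvTV.nonempty_extremalMaps hε.le u.continuous
    exact ⟨fun ν hν => E.refTV_eq_advTV hε hT u.continuous hν,
      E.isGreatest_integral_grad hε u.continuous μ,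
      E.isGreatest_integral_density hε u.continuous μ⟩
  · obtain ⟨E⟩ := AdvTV.nonempty_extremalMaps hε.le u.continuous
    simp only [AdvTV.neg_integral_pairDiv]
    exact E.isGreatest_integral_grad hε u.continuous μ
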